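/- Let $S\ge 2$ be an integer and let $H=\{x\in\mathbb{R}^S : x_i\ge 0,\ \sum_i x_i=1\}$ be the probability simplex, with centre $O=(1/S,\dots,1/S)$. Set $$u(S)=\frac{\mathrm{vol}\big((2O-H)\cap H\big)}{\mathrm{vol}(H)},\qquad v(S)=1-\frac{u(S)}{2},$$ where $\mathrm{vol}$ is the $(S-1)$-dimensional Euclidean volume. For a (reward-free) Markov decision process with $S$ states, $A$ actions, transition kernel $P$, initial distribution $\rho_0$ and discount factor $\gamma\in[0,1)$, a policy is a map $\pi$ from states to distributions over actions; it is deterministic if $\pi(\cdot\mid s)$ is a point mass for every $s$. Its discounted state distribution is $d_\pi(s)=(1-\gamma)\sum_{t\ge 0}\gamma^t\,\mathbb{P}_\pi(s^t=s)$, regarded as a point of $H$, and its state entropy is $\mathcal{H}(d_\pi)=-\sum_s d_\pi(s)\log d_\pi(s)$. Then: 1. $0<v(S)<1$. 2. There are $M=A^S$ deterministic policies. 3. In every such process, the set $D=\{d_\pi : \pi \text{ a policy}\}$ is the convex hull of the $M$ points $d_\pi$ with $\pi$ deterministic. Moreover, the following are equivalent: (a) a policy maximizing $\mathcal{H}(d_\pi)$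 exists, and every such policy $\hat\pi$ is not deterministic and satisfies $\mathcal{H}(d_{\hat\pi})=\log S$; (b) the entropy attains its maximum over $D$, and every maximizer is different from all points $d_\pi$ with $\pi$ deterministic and has entropy $\log S$. 4. Let $A\ge 2$, and model the discounted state distributions of the $M$ deterministic policies as $M$ independent random points, each uniformly distributed on $H$. Then, with probability at least $$1-M^S\,v(S)^M,$$ the state-entropy maximizer is not deterministic and has entropy $\log S$. That is, both of the following hold: property (b), with $D$ replaced by the convex hull of the $M$ random points and the points $d_\pi$ by the random points; and property (a), for every Markov decision process whose deterministic policies have exactly these points as their discounted state distributions. 5. For fixed $S$, the bound $1-M^S v(S)^M$ tends to $1$ as $A\to\infty$. Hence the probability in 4 tends to $1$, uniformly over all probability spaces carrying such random points. -/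

import Mathlib

open MeasureTheory ProbabilityTheory Filter Topology

noncomputable section

namespace StateEntropy

/-- A (reward-free) Markov decision process with `S` states and `A` actions: transition kernel,
initial state distribution and discount factor. The reward plays no role in the state
distributions. -/
structure MDP (S A : ℕ) where
  /-- `P s a` is the distribution of the next state after taking action `a` in state `s`. -/
  P : Fin S → Fin A → stdSimplex ℝ (Fin S)
  /-- The initial state distribution. -/
  ρ₀ : stdSimplex ℝ (Fin S)
  /-- The discount factor. -/
  γ : ℝ
  γ_nonneg : 0 ≤ γ
  γ_lt_one : γ < 1

/-- A (stochastic, stationary) policy `𝒮 → Δ(𝒜)`; `π s a` is the probability of action `a` in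
state `s`. -/
abbrev Policy (S A : ℕ) : Type := Fin S → stdSimplex ℝ (Fin A)

/-- The policy that takes action `f s` in state `s` with probability one. -/
def Policy.ofFun {S A : ℕ} (f : Fin S → Fin A) : Policy S A :=
  fun s => stdSimplex.vertex (f s)

/-- A policy is deterministic if in each state it puts all its mass on one action. -/
def Policy.IsDeterministic {S A : ℕ} (π : Policy S A) : Prop :=
  ∃ f : Fin S → Fin A, π = Policy.ofFun f

/-- `m.stateProb π t s` is the probability that the state at time `t` is `s` when the process
starts from `ρ₀` and actions are drawn from `π`. -/
def MDP.stateProb {S A : ℕ} (m : MDP S A) (π : Policy S A) : ℕ → Fin S → ℝ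
  | 0 => fun s => m.ρ₀ s
  | t + 1 => fun s' => ∑ s, ∑ a, m.stateProb π t s * π s a * m.P s a s'

/-- The discounted state distribution `d_π(s) = (1 - γ) ∑ₜ γᵗ ℙ(sᵗ = s)`, as a point of `ℝ^S`. -/
def MDP.d {S A : ℕ} (m : MDP S A) (π : Policy S A) : EuclideanSpace ℝ (Fin S) :=
  WithLp.toLp 2 fun s => (1 - m.γ) * ∑' t : ℕ, m.γ ^ t * m.stateProb π t s

/-- The set `D` of all feasible discounted state distributions. -/
def MDP.feasible {S A : ℕ} (m : MDP S A) : Set (EuclideanSpace ℝ (Fin S)) :=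
  Set.range fun π : Policy S A => m.d π

/-- Shannon entropy `∑ₛ - xₛ log xₛ` (with `0 log 0 = 0`). -/
def entropy {S : ℕ} (x : EuclideanSpace ℝ (Fin S)) : ℝ :=
  ∑ s, Real.negMulLog (x s)

/-- `π` maximizes the state entropy among all policies. -/
def MDP.IsMaxEntropyPolicy {S A : ℕ} (m : MDP S A) (π : Policy S A) : Prop :=
  ∀ π' : Policy S A, entropy (m.d π') ≤ entropy (m.d π)

/-- The state-entropy maximizing policy of `m` exists, is not deterministic, and has state entropy
`log S` (whichever maximizing policy is chosen). -/
def MDP.MaxEntropyNotDeterministic {S A : ℕ} (m : MDP S A) : Prop :=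
  (∃ π, m.IsMaxEntropyPolicy π) ∧
    ∀ π, m.IsMaxEntropyPolicy π → ¬ π.IsDeterministic ∧ entropy (m.d π) = Real.log S

/-- The same property for the convex polytope spanned by a family of points: the maximum of the
entropy over the polytope is attained, is attained at none of the given points, and equals
`log S`. -/
def MaxEntropyNotAtPoint {S : ℕ} {ι : Type} (p : ι → EuclideanSpace ℝ (Fin S)) : Prop :=
  (∃ x ∈ convexHull ℝ (Set.range p), IsMaxOn entropy (convexHull ℝ (Set.range p)) x) ∧
    ∀ x ∈ convexHull ℝ (Set.range p), IsMaxOn entropy (convexHull ℝ (Set.range p)) x →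
      (∀ i, x ≠ p i) ∧ entropy x = Real.log S

/-- The probability simplex `H` in `ℝ^S` with its Euclidean structure. -/
def simplex (S : ℕ) : Set (EuclideanSpace ℝ (Fin S)) :=
  {x | (∀ i, 0 ≤ x i) ∧ ∑ i, x i = 1}

/-- The uniform distribution on `H`: normalized `(S - 1)`-dimensional Euclidean volume. -/
def uniformSimplex (S : ℕ) : Measure (EuclideanSpace ℝ (Fin S)) :=
  ProbabilityTheory.cond (μHE[S - 1]) (simplex S)

/-- The centre `O = (1/S, …, 1/S)` of `H`. -/
def center (S : ℕ) : EuclideanSpace ℝ (Fin S) :=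
  WithLp.toLp 2 fun _ => 1 / (S : ℝ)

/-- `u = vol ((2 O - H) ∩ H) / vol H`. -/
def u (S : ℕ) : ℝ :=
  (μHE[S - 1] : Measure (EuclideanSpace ℝ (Fin S))).real
      ((fun x => (2 : ℝ) • center S - x) '' simplex S ∩ simplex S) /
    (μHE[S - 1] : Measure (EuclideanSpace ℝ (Fin S))).real (simplex S)

/-- The constant `v(S) = 1 - u / 2`, which depends only on `S`. -/
def v (S : ℕ) : ℝ := 1 - u S / 2

/-- The lower bound `1 - M^S v(S)^M` with `M = A^S`. -/
def bound (S A : ℕ) : ℝ := 1 - ((A ^ S : ℕ) : ℝ) ^ S * v S ^ (A ^ S)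

/-- The random points `X f`, indexed by the deterministic policies `f : 𝒮 → 𝒜`, are i.i.d. and
uniformly distributed on the simplex `H`. -/
def IsIIDUniform {S A : ℕ} {Ω : Type*} [MeasurableSpace Ω] (μ : Measure Ω)
    (X : (Fin S → Fin A) → Ω → EuclideanSpace ℝ (Fin S)) : Prop :=
  iIndepFun X μ ∧ ∀ f, HasLaw (X f) (uniformSimplex S) μ

/-- The event, for points `x f` playing the role of the state distributions of the deterministic
policies, that the state-entropy maximizer is not deterministic and has entropy `log S`. It is
required of the feasible polytope spanned by the points, and of the policies of every MDP whose
deterministic policies have exactly these state distributions. -/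
def Good {S A : ℕ} (x : (Fin S → Fin A) → EuclideanSpace ℝ (Fin S)) : Prop :=
  MaxEntropyNotAtPoint x ∧
    ∀ m : MDP S A, (∀ f, m.d (Policy.ofFun f) = x f) → m.MaxEntropyNotDeterministic

end StateEntropy

end

open StateEntropy

namespace StateEntropy

/-! Entropy on the simplex `H` is at most `log S`, with equality only at the centre `O`. So it
suffices that `O` lies in the hull of the points, given that they lie in `H` and differ from `O`
(`maxEntropyNotAtPoint_of_center_mem`). In an MDP that hull is all of `D`: `d_π` is the unique
solution of a linear flow equation, mixing occupancies makes `D` convex, and randomization can be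
removed one state at a time (`MDP.d_mem_convexHull_update`).

If `O` is outside the hull, Hahn–Banach puts all `x i - O` in one open half-space. Reflecting in `O`
those points of a chosen subfamily that lie in the core `(2O - H) ∩ H` preserves the joint law, so
the probability `p` of this event is an average over the `2^M` subfamilies. For fixed points, a set
shattered by the admissible reflections has at most `S` elements, so Sauer–Shelah leaves at most
`M^S` choices on the core, while each point outside it contributes a free factor 2
(`card_reflections_le`). Integrating over independent points gives `2^M p ≤ M^S (2 - u)^M = M^S
(2v)^M`. -/

/-! ### Entropy on the simplex -/

lemma entropy_le_and_eq_center {S : ℕ} (hS : 0 < S) {x : EuclideanSpace ℝ (Fin S)}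
    (hx : x ∈ simplex S) :
    entropy x ≤ Real.log S ∧ (entropy x = Real.log S → x = center S) := by
  have hS' : (0 : ℝ) < S := by exact_mod_cast hS
  -- The right side is the tangent line of `negMulLog` at `1/S`; its terms `1/S - t` cancel when
  -- summed over the coordinates.
  have key : ∀ t : ℝ, 0 ≤ t → Real.negMulLog t ≤ t * Real.log S + (1 / S - t) ∧
      (Real.negMulLog t = t * Real.log S + (1 / S - t) → t = 1 / S) := by
    intro t ht
    rcases ht.eq_or_lt with rfl | ht
    · refine ⟨by simp, fun h => ?_⟩
      rw [Real.negMulLog_zero] at h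
      linarith
    · have hpos : 0 < 1 / (S * t) := by positivity
      have hlog : Real.log (1 / (S * t)) = -Real.log S - Real.log t := by
        rw [one_div, Real.log_inv, Real.log_mul hS'.ne' ht.ne']; ring
      have e2 : t * (1 / (S * t) - 1) = 1 / S - t := by field_simp
      have e1 : Real.negMulLog t = t * Real.log S + t * Real.log (1 / (S * t)) := by
        rw [hlog, Real.negMulLog]; ring
      rw [e1, ← e2]
      refine ⟨by gcongr; exact Real.log_le_sub_one_of_pos hpos, fun h => ?_⟩
      by_contra hne
      have : 1 / (S * t) ≠ 1 := by
        intro h1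
        apply hne
        field_simp at h1 ⊢
        linarith
      have := mul_lt_mul_of_pos_left (Real.log_lt_sub_one_of_pos hpos this) ht
      linarith
  have hsum : ∑ s, (x s * Real.log S + (1 / S - x s)) = Real.log S := by
    rw [Finset.sum_add_distrib, ← Finset.sum_mul, Finset.sum_sub_distrib, hx.2]
    simp [hS'.ne']
  have hle : ∀ s ∈ Finset.univ, Real.negMulLog (x s) ≤ x s * Real.log S + (1 / S - x s) :=
    fun s _ => (key _ (hx.1 s)).1
  refine ⟨by rw [← hsum]; exact Finset.sum_le_sum hle, fun h => ?_⟩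
  rw [← hsum] at h
  have := (Finset.sum_eq_sum_iff_of_le hle).1 h
  ext s
  exact (key _ (hx.1 s)).2 (this s (Finset.mem_univ s))

lemma entropy_center {S : ℕ} : entropy (center S) = Real.log S := by
  rcases Nat.eq_zero_or_pos S with rfl | hS
  · simp [entropy]
  · have : (S : ℝ) ≠ 0 := by positivity
    simp [entropy, center, Real.negMulLog]
    field_simp

lemma convex_simplex (S : ℕ) : Convex ℝ (simplex S) := by
  intro x hx y hy a b ha hb hab
  refine ⟨fun i => ?_, ?_⟩
  · have := hx.1 i
    have := hy.1 i
    simp only [PiLp.add_apply, PiLp.smul_apply, smul_eq_mul]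
    positivity
  · simp only [PiLp.add_apply, PiLp.smul_apply, smul_eq_mul]
    rw [Finset.sum_add_distrib, ← Finset.mul_sum, ← Finset.mul_sum, hx.2, hy.2]
    linarith

lemma maxEntropyNotAtPoint_of_center_mem {S : ℕ} (hS : 0 < S) {ι : Type}
    {p : ι → EuclideanSpace ℝ (Fin S)} (hp : ∀ i, p i ∈ simplex S)
    (hne : ∀ i, p i ≠ center S) (hc : center S ∈ convexHull ℝ (Set.range p)) :
    MaxEntropyNotAtPoint p := by
  have hsub : convexHull ℝ (Set.range p) ⊆ simplex S :=
    convexHull_min (by rintro _ ⟨i, rfl⟩; exact hp i) (convex_simplex S)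
  refine ⟨⟨_, hc, fun y hy => ?_⟩, fun x hx hmax => ?_⟩
  · simp only [Set.mem_ofPred_eq, entropy_center]
    exact (entropy_le_and_eq_center hS (hsub hy)).1
  · have h1 : Real.log S ≤ entropy x := entropy_center (S := S) ▸ hmax hc
    have h2 := entropy_le_and_eq_center hS (hsub hx)
    have h3 := le_antisymm h2.1 h1
    exact ⟨fun i hi => hne i (hi ▸ h2.2 h3), h3⟩

/-! ### Discounted state distributions -/

namespace MDP

variable {S A : ℕ} (m : MDP S A) (π : Policy S A)

/-- The Bellman flow equation of the policy `π`. -/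
def IsFlow (z : Fin S → ℝ) : Prop :=
  ∀ s', z s' = (1 - m.γ) * m.ρ₀ s' + m.γ * ∑ s, ∑ a, z s * π s a * m.P s a s'

lemma sum_flow (z : Fin S → ℝ) : ∑ s', ∑ s, ∑ a, z s * π s a * m.P s a s' = ∑ s, z s := by
  rw [Finset.sum_comm]
  refine Finset.sum_congr rfl fun s _ => ?_
  rw [Finset.sum_comm]
  simp_rw [← Finset.mul_sum, stdSimplex.sum_eq_one, mul_one, ← Finset.mul_sum,
    stdSimplex.sum_eq_one, mul_one]

lemma stateProb_nonneg (t : ℕ) (s : Fin S) : 0 ≤ m.stateProb π t s := by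
  induction t generalizing s with
  | zero => exact stdSimplex.zero_le _ _
  | succ t ih =>
    exact Finset.sum_nonneg fun s' _ => Finset.sum_nonneg fun a _ =>
      mul_nonneg (mul_nonneg (ih s') (stdSimplex.zero_le _ _)) (stdSimplex.zero_le _ _)

lemma sum_stateProb (t : ℕ) : ∑ s, m.stateProb π t s = 1 := by
  induction t with
  | zero => exact stdSimplex.sum_eq_one _
  | succ t ih => rw [← ih]; exact m.sum_flow π _

lemma stateProb_le_one (t : ℕ) (s : Fin S) : m.stateProb π t s ≤ 1 := by
  rw [← m.sum_stateProb π t]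
  exact Finset.single_le_sum (fun s _ => m.stateProb_nonneg π t s) (Finset.mem_univ s)

lemma summable_stateProb (s : Fin S) : Summable fun t => m.γ ^ t * m.stateProb π t s :=
  Summable.of_nonneg_of_le
    (fun t => mul_nonneg (pow_nonneg m.γ_nonneg _) (m.stateProb_nonneg π t s))
    (fun t => mul_le_of_le_one_right (pow_nonneg m.γ_nonneg _) (m.stateProb_le_one π t s))
    (summable_geometric_of_lt_one m.γ_nonneg m.γ_lt_one)

lemma isFlow_d : m.IsFlow π (m.d π) := by
  intro s'
  have hsum : ∀ s a, Summable fun t => m.γ ^ t * m.stateProb π t s * (π s a * m.P s a s') :=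
    fun s a => (m.summable_stateProb π s).mul_right _
  simp only [d]
  rw [(m.summable_stateProb π s').tsum_eq_zero_add]
  have : ∀ t, m.γ ^ (t + 1) * m.stateProb π (t + 1) s' =
      m.γ * ∑ s, ∑ a, m.γ ^ t * m.stateProb π t s * (π s a * m.P s a s') := by
    intro t
    simp only [stateProb, pow_succ, Finset.mul_sum]
    exact Finset.sum_congr rfl fun s _ => Finset.sum_congr rfl fun a _ => by ring
  simp_rw [this]
  rw [tsum_mul_left, Summable.tsum_finsetSum fun s _ => summable_sum fun a _ => hsum s a]
  simp_rw [Summable.tsum_finsetSum fun a _ => hsum _ a, tsum_mul_right]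
  simp only [pow_zero, stateProb, one_mul, mul_add, Finset.mul_sum]
  congr 1
  exact Finset.sum_congr rfl fun s _ => Finset.sum_congr rfl fun a _ => by ring

variable {m π}

/-- Transitions preserve total mass, so the flow map contracts the ℓ¹ distance by the factor `γ <
1`. -/
lemma IsFlow.unique {z w : Fin S → ℝ} (hz : m.IsFlow π z) (hw : m.IsFlow π w) : z = w := by
  have h1 : ∀ s', |z s' - w s'| ≤ m.γ * ∑ s, ∑ a, |z s - w s| * π s a * m.P s a s' := by
    intro s'
    have : z s' - w s' = m.γ * ∑ s, ∑ a, (z s - w s) * π s a * m.P s a s' := by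
      rw [hz s', hw s']
      simp_rw [sub_mul, Finset.sum_sub_distrib]
      ring
    rw [this, abs_mul, abs_of_nonneg m.γ_nonneg]
    refine mul_le_mul_of_nonneg_left ?_ m.γ_nonneg
    refine (Finset.abs_sum_le_sum_abs _ _).trans (Finset.sum_le_sum fun s _ => ?_)
    refine (Finset.abs_sum_le_sum_abs _ _).trans (Finset.sum_le_sum fun a _ => ?_)
    rw [abs_mul, abs_mul, abs_of_nonneg (stdSimplex.zero_le (π s) a),
      abs_of_nonneg (stdSimplex.zero_le (m.P s a) s')]
  have h2 := Finset.sum_le_sum fun s (_ : s ∈ Finset.univ) => h1 s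
  rw [← Finset.mul_sum, m.sum_flow π] at h2
  have h3 : ∑ s, |z s - w s| = 0 := by
    have : 0 ≤ ∑ s, |z s - w s| := Finset.sum_nonneg fun _ _ => abs_nonneg _
    nlinarith [m.γ_lt_one]
  funext s
  have := (Finset.sum_eq_zero_iff_of_nonneg fun _ _ => abs_nonneg _).1 h3 s (Finset.mem_univ s)
  exact sub_eq_zero.1 (abs_eq_zero.1 this)

lemma IsFlow.eq_d {z : EuclideanSpace ℝ (Fin S)} (hz : m.IsFlow π z) : z = m.d π := by
  ext s
  exact congrFun (hz.unique (m.isFlow_d π)) s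

variable (m π)

lemma d_nonneg (s : Fin S) : 0 ≤ m.d π s :=
  mul_nonneg (sub_nonneg.2 m.γ_lt_one.le) (tsum_nonneg fun t =>
    mul_nonneg (pow_nonneg m.γ_nonneg _) (m.stateProb_nonneg π t s))

/-- Mixtures of state distributions are realized by mixing the state-action occupancies. -/
lemma convex_feasible : Convex ℝ m.feasible := by
  rintro _ ⟨π₁, rfl⟩ _ ⟨π₂, rfl⟩ p q hp hq hpq
  set z : EuclideanSpace ℝ (Fin S) := p • m.d π₁ + q • m.d π₂ with hz
  have hzs : ∀ s, z s = p * m.d π₁ s + q * m.d π₂ s := fun s => by simp [hz]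
  have h1 := fun s => mul_nonneg hp (m.d_nonneg π₁ s)
  have h2 := fun s => mul_nonneg hq (m.d_nonneg π₂ s)
  have hex : ∀ s, ∃ y : stdSimplex ℝ (Fin A), ∀ a,
      z s * y a = p * m.d π₁ s * π₁ s a + q * m.d π₂ s * π₂ s a := by
    intro s
    -- At a state of zero mass both occupancies vanish, so any action distribution serves.
    by_cases h0 : z s = 0
    · refine ⟨π₁ s, fun a => ?_⟩
      have e1 : p * m.d π₁ s = 0 := by linarith [h1 s, h2 s, hzs s]
      have e2 : q * m.d π₂ s = 0 := by linarith [h1 s, h2 s, hzs s]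
      simp [h0, e1, e2]
    · have hpos : 0 < z s := lt_of_le_of_ne (by linarith [h1 s, h2 s, hzs s]) (Ne.symm h0)
      refine ⟨⟨fun a => (p * m.d π₁ s * π₁ s a + q * m.d π₂ s * π₂ s a) / z s,
        fun a => div_nonneg (add_nonneg (mul_nonneg (h1 s) (stdSimplex.zero_le _ _))
          (mul_nonneg (h2 s) (stdSimplex.zero_le _ _))) hpos.le, ?_⟩, fun a => ?_⟩
      · rw [← Finset.sum_div, Finset.sum_add_distrib, ← Finset.mul_sum, ← Finset.mul_sum,
          stdSimplex.sum_eq_one, stdSimplex.sum_eq_one, mul_one, mul_one, ← hzs, div_self h0]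
      · exact mul_div_cancel₀ _ h0
  choose π' hπ' using hex
  refine ⟨π', ?_⟩
  refine (IsFlow.eq_d (fun s' => ?_)).symm
  simp_rw [hπ']
  rw [hzs, m.isFlow_d π₁ s', m.isFlow_d π₂ s']
  simp_rw [add_mul, Finset.sum_add_distrib, mul_assoc p, mul_assoc q, ← Finset.mul_sum]
  linear_combination ((1 - m.γ) * m.ρ₀ s') * hpq

/-- The flow through a policy differs from the flow through its modification in the state `s₀`
only by the contribution of `s₀`. -/
lemma sum_update (s₀ : Fin S) (y : stdSimplex ℝ (Fin A)) (z : Fin S → ℝ) (s' : Fin S) :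
    ∑ s, ∑ a, z s * Function.update π s₀ y s a * m.P s a s' =
      ∑ s ∈ Finset.univ.erase s₀, ∑ a, z s * π s a * m.P s a s' +
        z s₀ * ∑ a, y a * m.P s₀ a s' := by
  rw [← Finset.sum_erase_add _ _ (Finset.mem_univ s₀)]
  congr 1
  · refine Finset.sum_congr rfl fun s hs => ?_
    rw [Function.update_of_ne (Finset.ne_of_mem_erase hs)]
  · simp [Finset.mul_sum, mul_assoc]

/-- Mix the distributions `e a` so that the mass passing through `s₀` with action `a` is
proportional to `π s₀ a`. The mixture then solves the flow equation of `π`. This forces weights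
proportional to `π s₀ a / e a s₀`. -/
lemma d_mem_convexHull_update (s₀ : Fin S) :
    m.d π ∈ convexHull ℝ
      (Set.range fun a : Fin A => m.d (Function.update π s₀ (stdSimplex.vertex a))) := by
  set e : Fin A → EuclideanSpace ℝ (Fin S) :=
    fun a => m.d (Function.update π s₀ (stdSimplex.vertex a)) with he
  have hflow : ∀ a s', e a s' = (1 - m.γ) * m.ρ₀ s' +
      m.γ * (∑ s ∈ Finset.univ.erase s₀, ∑ b, e a s * π s b * m.P s b s' +
        e a s₀ * m.P s₀ a s') := by
    intro a s'
    rw [he, m.isFlow_d _ s', sum_update]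
    simp [Pi.single_apply]
  have hπ : ∀ (z : Fin S → ℝ) s', ∑ s, ∑ a, z s * π s a * m.P s a s' =
      ∑ s ∈ Finset.univ.erase s₀, ∑ a, z s * π s a * m.P s a s' +
        z s₀ * ∑ a, π s₀ a * m.P s₀ a s' := by
    intro z s'
    have := m.sum_update π s₀ (π s₀) z s'
    rwa [Function.update_eq_self] at this
  -- If some `e a` gives `s₀` no mass, the choice at `s₀` does not affect the flow and `e a` is
  -- already `d_π`.
  by_cases h0 : ∃ a, e a s₀ = 0
  · obtain ⟨a, ha⟩ := h0
    have : e a = m.d π := IsFlow.eq_d fun s' => by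
      rw [hπ, hflow, ha]; ring
    rw [← this]
    exact subset_convexHull _ _ ⟨a, rfl⟩
  · push Not at h0
    have hpos : ∀ a, 0 < e a s₀ := fun a => lt_of_le_of_ne (m.d_nonneg _ _) (h0 a).symm
    have hnn : ∀ a, 0 ≤ π s₀ a / e a s₀ :=
      fun a => div_nonneg (stdSimplex.zero_le _ _) (hpos a).le
    set C := ∑ a, π s₀ a / e a s₀ with hC
    have hCpos : 0 < C := by
      refine Finset.sum_pos' (fun a _ => hnn a) ?_
      by_contra! hcon
      have : ∑ a, π s₀ a = 0 := Finset.sum_eq_zero fun a ha => by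
        have h1 := le_antisymm (hcon a ha) (hnn a)
        exact (div_eq_zero_iff.1 h1).resolve_right (h0 a)
      rw [stdSimplex.sum_eq_one] at this
      exact one_ne_zero this
    set w : Fin A → ℝ := fun a => π s₀ a / e a s₀ / C with hw
    have hw1 : ∑ a, w a = 1 := by rw [hw, ← Finset.sum_div, div_self hCpos.ne']
    have hw2 : ∀ a, w a * e a s₀ = C⁻¹ * π s₀ a := fun a => by
      have := h0 a
      simp only [hw]; field_simp
    have hmem : ∑ a, w a • e a ∈ convexHull ℝ (Set.range e) :=
      (convex_convexHull ℝ _).sum_mem (fun a _ => div_nonneg (hnn a) hCpos.le) hw1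
        fun a _ => subset_convexHull _ _ ⟨a, rfl⟩
    have hzs : ∀ s, (∑ a, w a • e a) s = ∑ a, w a * e a s := fun s => by simp
    have hz0 : ∑ a, w a * e a s₀ = C⁻¹ := by
      simp_rw [hw2, ← Finset.mul_sum, stdSimplex.sum_eq_one, mul_one]
    convert hmem
    refine (IsFlow.eq_d fun s' => ?_).symm
    rw [hπ]
    simp_rw [hzs, hz0]
    have : ∀ a, w a * e a s' = w a * ((1 - m.γ) * m.ρ₀ s') +
      m.γ * (∑ s ∈ Finset.univ.erase s₀, ∑ b, w a * e a s * π s b * m.P s b s') +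
        m.γ * (C⁻¹ * (π s₀ a * m.P s₀ a s')) := by
      intro a
      rw [hflow]
      have h2 := hw2 a
      simp_rw [mul_assoc (w a), ← Finset.mul_sum]
      linear_combination m.γ * m.P s₀ a s' * h2
    have hmid : ∑ s ∈ Finset.univ.erase s₀, ∑ b, (∑ a, w a * e a s) * π s b * m.P s b s' =
        ∑ a, ∑ s ∈ Finset.univ.erase s₀, ∑ b, w a * e a s * π s b * m.P s b s' := by
      simp_rw [Finset.sum_mul]
      rw [Finset.sum_comm (s := (Finset.univ : Finset (Fin A)))]
      exact Finset.sum_congr rfl fun s _ => Finset.sum_comm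
    rw [hmid, Finset.sum_congr rfl fun a _ => this a, Finset.sum_add_distrib,
      Finset.sum_add_distrib, ← Finset.sum_mul, hw1, ← Finset.mul_sum, ← Finset.mul_sum,
      ← Finset.mul_sum]
    ring

lemma d_mem_convexHull_partial (T : Finset (Fin S)) :
    m.d π ∈ convexHull ℝ (Set.range fun f : Fin S → Fin A =>
      m.d fun s => if s ∈ T then stdSimplex.vertex (f s) else π s) := by
  induction T using Finset.induction_on with
  | empty =>
    -- An action exists because `π s` has total mass 1.
    refine subset_convexHull _ _ ⟨fun s => Classical.choice ?_, by simp⟩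
    by_contra hA
    have := not_nonempty_iff.1 hA
    have := stdSimplex.sum_eq_one (π s)
    simp at this
  | insert s₀ T hs ih =>
    refine convexHull_min ?_ (convex_convexHull ℝ _) ih
    rintro _ ⟨f, rfl⟩
    refine convexHull_mono ?_ (m.d_mem_convexHull_update _ s₀)
    rintro _ ⟨a, rfl⟩
    refine ⟨Function.update f s₀ a, ?_⟩
    dsimp only
    congr 1
    funext s
    by_cases h : s = s₀
    · subst h; simp
    · simp [h]

lemma feasible_eq_convexHull :
    m.feasible = convexHull ℝ (Set.range fun f => m.d (Policy.ofFun f)) := by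
  refine Set.Subset.antisymm ?_ (convexHull_min ?_ m.convex_feasible)
  · rintro _ ⟨π, rfl⟩
    have h := m.d_mem_convexHull_partial π Finset.univ
    simp only [Finset.mem_univ, if_true] at h
    exact h
  · rintro _ ⟨f, rfl⟩
    exact ⟨_, rfl⟩

/-- A nondeterministic maximizer might share its distribution with a deterministic policy; that
policy would then be a maximizer too, so excluding deterministic maximizers also excludes the points
themselves. -/
lemma maxEntropyNotDeterministic_iff :
    m.MaxEntropyNotDeterministic ↔ MaxEntropyNotAtPoint fun f => m.d (Policy.ofFun f) := by
  have hmax : ∀ π, m.IsMaxEntropyPolicy π ↔ IsMaxOn entropy m.feasible (m.d π) := fun π => by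
    simp [IsMaxEntropyPolicy, IsMaxOn, IsMaxFilter, feasible]
  unfold MaxEntropyNotDeterministic MaxEntropyNotAtPoint
  rw [← m.feasible_eq_convexHull]
  refine and_congr ?_ ?_
  · simp_rw [hmax]
    simp [feasible]
  · simp_rw [hmax]
    constructor
    · rintro h _ ⟨π, rfl⟩ hπ
      refine ⟨fun f hf => ?_, (h π hπ).2⟩
      dsimp only at hf hπ
      rw [hf] at hπ
      exact (h _ hπ).1 ⟨f, rfl⟩
    · intro h π hπ
      refine ⟨?_, (h _ ⟨π, rfl⟩ hπ).2⟩
      rintro ⟨f, rfl⟩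
      exact (h _ ⟨_, rfl⟩ hπ).1 f rfl

end MDP

lemma card_isDeterministic (S A : ℕ) :
    Nat.card {π : Policy S A // π.IsDeterministic} = A ^ S := by
  have hinj : Function.Injective (Policy.ofFun : (Fin S → Fin A) → Policy S A) := fun f g h =>
    funext fun s => stdSimplex.vertex_injective (congrFun h s)
  have hset : {π : Policy S A | π.IsDeterministic} = Set.range Policy.ofFun := by
    ext π
    simp [Policy.IsDeterministic, eq_comm]
  change Nat.card ({π : Policy S A | π.IsDeterministic} : Set _) = _
  rw [hset, Nat.card_range_of_injective hinj]
  simp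

/-! ### Volumes of subsets of the simplex -/

/-- The intersection of the simplex with its reflection in the centre. -/
def core (S : ℕ) : Set (EuclideanSpace ℝ (Fin S)) :=
  (fun x => (2 : ℝ) • center S - x) '' simplex S ∩ simplex S

lemma mem_core {S : ℕ} {x : EuclideanSpace ℝ (Fin S)} :
    x ∈ core S ↔ (2 : ℝ) • center S - x ∈ simplex S ∧ x ∈ simplex S := by
  refine and_congr_left fun _ => ⟨?_, fun h => ⟨_, h, by simp⟩⟩
  rintro ⟨y, hy, rfl⟩
  simpa using hy

lemma isClosed_simplex (S : ℕ) : IsClosed (simplex S) := by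
  have : simplex S = (⋂ i, {x | 0 ≤ x i}) ∩ {x | ∑ i, x i = 1} := by
    ext x; simp [simplex]
  rw [this]
  exact (isClosed_iInter fun i => isClosed_le continuous_const (by fun_prop)).inter
    (isClosed_eq (by fun_prop) continuous_const)

lemma isClosed_core (S : ℕ) : IsClosed (core S) := by
  have : core S = (fun x => (2 : ℝ) • center S - x) ⁻¹' simplex S ∩ simplex S := by
    ext x; exact mem_core
  rw [this]
  exact ((isClosed_simplex S).preimage (by fun_prop)).inter (isClosed_simplex S)

/-- The direction of the hyperplane spanned by the simplex. -/
noncomputable def zeroSum (S : ℕ) : Submodule ℝ (EuclideanSpace ℝ (Fin S)) :=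
  (ℝ ∙ center S)ᗮ

lemma mem_zeroSum {S : ℕ} (hS : 0 < S) {w : EuclideanSpace ℝ (Fin S)} :
    w ∈ zeroSum S ↔ ∑ i, w i = 0 := by
  rw [zeroSum, Submodule.mem_orthogonal_singleton_iff_inner_right, PiLp.inner_apply]
  simp [center, ← Finset.sum_mul, hS.ne']

lemma finrank_zeroSum {S : ℕ} (hS : 0 < S) : Module.finrank ℝ (zeroSum S) = S - 1 := by
  obtain ⟨n, rfl⟩ : ∃ n, S = n + 1 := ⟨S - 1, by omega⟩
  have : Fact (Module.finrank ℝ (EuclideanSpace ℝ (Fin (n + 1))) = n + 1) := ⟨by simp⟩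
  refine Submodule.finrank_orthogonal_span_singleton (n := n) fun h => ?_
  have := congrArg (fun x : EuclideanSpace ℝ (Fin (n + 1)) => x 0) h
  simp [center] at this
  norm_cast at this

lemma sum_center {S : ℕ} (hS : 0 < S) : ∑ i, center S i = 1 := by
  simp [center, hS.ne']

lemma isometry_center_add (S : ℕ) :
    Isometry fun w : zeroSum S => center S + (w : EuclideanSpace ℝ (Fin S)) :=
  (isometry_add_left _).comp isometry_subtype_coe

lemma simplex_subset_range {S : ℕ} (hS : 0 < S) :
    simplex S ⊆ Set.range fun w : zeroSum S => center S + (w : EuclideanSpace ℝ (Fin S)) := by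
  intro x hx
  refine ⟨⟨x - center S, ?_⟩, by simp⟩
  rw [mem_zeroSum hS]
  simp [Finset.sum_sub_distrib, hx.2, sum_center hS]

lemma euclideanHausdorffMeasure_eq_volume_preimage {S : ℕ} (hS : 0 < S)
    {s : Set (EuclideanSpace ℝ (Fin S))} (hs : s ⊆ simplex S) :
    μHE[S - 1] s =
      volume ((fun w : zeroSum S => center S + (w : EuclideanSpace ℝ (Fin S))) ⁻¹' s) := by
  rw [← InnerProductSpace.euclideanHausdorffMeasure_eq_volume, finrank_zeroSum hS,
    (isometry_center_add S).euclideanHausdorffMeasure_preimage,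
    Set.inter_eq_left.2 (hs.trans (simplex_subset_range hS))]

lemma isBounded_simplex (S : ℕ) : Bornology.IsBounded (simplex S) := by
  refine (Metric.isBounded_closedBall (x := (0 : EuclideanSpace ℝ (Fin S))) (r := 1)).subset ?_
  intro x hx
  rw [mem_closedBall_zero_iff, EuclideanSpace.norm_eq, Real.sqrt_le_one]
  rw [← hx.2]
  refine Finset.sum_le_sum fun i _ => ?_
  have h0 := hx.1 i
  have h1 : x i ≤ 1 := by
    rw [← hx.2]; exact Finset.single_le_sum (fun i _ => hx.1 i) (Finset.mem_univ i)
  rw [Real.norm_eq_abs, sq_abs]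
  nlinarith

lemma measure_simplex_ne_top {S : ℕ} (hS : 0 < S) :
    (μHE[S - 1] : Measure (EuclideanSpace ℝ (Fin S))) (simplex S) ≠ ⊤ := by
  rw [euclideanHausdorffMeasure_eq_volume_preimage hS subset_rfl]
  exact ((isometry_center_add S).antilipschitz.isBounded_preimage
    (isBounded_simplex S)).measure_lt_top.ne

/-- Within the hyperplane, the core contains the ball of radius `1/S` about the centre: `|w i| ≤
1/S` keeps both `1/S + w i` and `1/S - w i` nonnegative. -/
lemma measure_core_ne_zero {S : ℕ} (hS : 0 < S) :
    (μHE[S - 1] : Measure (EuclideanSpace ℝ (Fin S))) (core S) ≠ 0 := by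
  rw [euclideanHausdorffMeasure_eq_volume_preimage hS (show core S ⊆ simplex S from
    Set.inter_subset_right)]
  refine (Measure.measure_pos_of_mem_nhds (x := 0) _ (Filter.mem_of_superset
    (Metric.closedBall_mem_nhds 0 (ε := 1 / (S : ℝ)) (by positivity)) ?_)).ne'
  intro w hw
  have hsum := (mem_zeroSum hS).1 w.2
  have hcoord : ∀ i, |(w : EuclideanSpace ℝ (Fin S)) i| ≤ 1 / S := fun i => by
    rw [mem_closedBall_zero_iff] at hw
    exact (PiLp.norm_apply_le (w : EuclideanSpace ℝ (Fin S)) i).trans hw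
  have hc : ∀ i, center S i = 1 / S := fun i => rfl
  rw [Set.mem_preimage, mem_core]
  refine ⟨⟨fun i => ?_, ?_⟩, ⟨fun i => ?_, ?_⟩⟩
  · have := abs_le.1 (hcoord i)
    simp only [PiLp.sub_apply, PiLp.add_apply, PiLp.smul_apply, smul_eq_mul, hc]
    linarith
  · simp only [PiLp.sub_apply, PiLp.add_apply, PiLp.smul_apply, smul_eq_mul]
    rw [Finset.sum_sub_distrib, Finset.sum_add_distrib, ← Finset.mul_sum, sum_center hS, hsum]
    norm_num
  · have := abs_le.1 (hcoord i)
    simp only [PiLp.add_apply, hc]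
    linarith
  · simp only [PiLp.add_apply]
    rw [Finset.sum_add_distrib, sum_center hS, hsum, add_zero]

lemma measure_simplex_ne_zero {S : ℕ} (hS : 0 < S) :
    (μHE[S - 1] : Measure (EuclideanSpace ℝ (Fin S))) (simplex S) ≠ 0 := fun h =>
  measure_core_ne_zero hS (measure_mono_null Set.inter_subset_right h)

lemma uniformSimplex_core {S : ℕ} : (uniformSimplex S).real (core S) = u S := by
  rw [Measure.real, uniformSimplex, ProbabilityTheory.cond_apply (isClosed_simplex S).measurableSet,
    Set.inter_eq_right.2 (show core S ⊆ simplex S from Set.inter_subset_right), ENNReal.toReal_mul,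
    ENNReal.toReal_inv, inv_mul_eq_div]
  rfl

lemma isProbabilityMeasure_uniformSimplex {S : ℕ} (hS : 0 < S) :
    IsProbabilityMeasure (uniformSimplex S) :=
  ProbabilityTheory.cond_isProbabilityMeasure_of_finite (measure_simplex_ne_zero hS)
    (measure_simplex_ne_top hS)

lemma u_pos {S : ℕ} (hS : 0 < S) : 0 < u S := by
  have h1 := measure_simplex_ne_top hS
  exact div_pos
    (ENNReal.toReal_pos (measure_core_ne_zero hS) (measure_ne_top_of_subset Set.inter_subset_right h1))
    (ENNReal.toReal_pos (measure_simplex_ne_zero hS) h1)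

lemma u_le_one {S : ℕ} (hS : 0 < S) : u S ≤ 1 := by
  have := isProbabilityMeasure_uniformSimplex hS
  rw [← uniformSimplex_core]
  exact measureReal_le_one

lemma ae_mem_simplex (S : ℕ) : ∀ᵐ x ∂uniformSimplex S, x ∈ simplex S :=
  ProbabilityTheory.ae_cond_mem (isClosed_simplex S).measurableSet

/-- Hausdorff measure of positive dimension has no atoms; `2 ≤ S` makes `S - 1` positive. -/
lemma ae_ne_center {S : ℕ} (hS : 2 ≤ S) : ∀ᵐ x ∂uniformSimplex S, x ≠ center S := by
  refine (ProbabilityTheory.cond_absolutelyContinuous (s := simplex S)).ae_le ?_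
  have hpos : (0 : ℝ) < ((S - 1 : ℕ) : ℝ) := by
    rw [Nat.cast_pos]; omega
  have := Measure.nullSingletonClass_hausdorff (EuclideanSpace ℝ (Fin S)) hpos
  rw [Measure.euclideanHausdorffMeasure_def]
  refine Measure.ae_smul_measure ?_ _
  rw [ae_iff]
  simp

/-- Reflect the points of the core in the centre, and fix all other points. -/
noncomputable def reflect (S : ℕ) (x : EuclideanSpace ℝ (Fin S)) : EuclideanSpace ℝ (Fin S) :=
  open Classical in if x ∈ core S then (2 : ℝ) • center S - x else x

lemma sub_mem_core {S : ℕ} {x : EuclideanSpace ℝ (Fin S)} :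
    (2 : ℝ) • center S - x ∈ core S ↔ x ∈ core S := by
  simp [mem_core, and_comm]

lemma measurable_reflect (S : ℕ) : Measurable (reflect S) := by
  classical
  exact Measurable.ite (isClosed_core S).measurableSet (by fun_prop) measurable_id

/-- The core is symmetric about the centre, so the map is an isometry of the core onto itself and
the identity elsewhere. -/
lemma measurePreserving_reflect (S : ℕ) :
    MeasurePreserving (reflect S) (uniformSimplex S) (uniformSimplex S) := by
  refine ⟨measurable_reflect S, Measure.ext fun s hs => ?_⟩
  have hK := (isClosed_core S).measurableSet
  have hiso : MeasurePreserving (fun x => (2 : ℝ) • center S - x)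
      (μHE[S - 1] : Measure (EuclideanSpace ℝ (Fin S))) μHE[S - 1] :=
    (IsometryEquiv.subLeft ((2 : ℝ) • center S)).measurePreserving_euclideanHausdorffMeasure _
  rw [Measure.map_apply (measurable_reflect S) hs, ← measure_inter_add_sdiff _ hK,
    ← measure_inter_add_sdiff s hK]
  congr 1
  · have h1 : reflect S ⁻¹' s ∩ core S = (fun x => (2 : ℝ) • center S - x) ⁻¹' (s ∩ core S) := by
      ext x
      simp only [Set.mem_inter_iff, Set.mem_preimage, sub_mem_core]
      refine and_congr_left fun hx => ?_
      simp [reflect, hx]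
    have h2 : ∀ t ⊆ core S, uniformSimplex S t = (μHE[S - 1] (simplex S))⁻¹ * μHE[S - 1] t := fun t ht => by
      rw [uniformSimplex, ProbabilityTheory.cond_apply (isClosed_simplex S).measurableSet,
        Set.inter_eq_right.2 (ht.trans Set.inter_subset_right)]
    rw [h2 _ Set.inter_subset_right, h2 _ Set.inter_subset_right, h1,
      hiso.measure_preimage (hs.inter hK).nullMeasurableSet]
  · congr 1
    ext x
    simp only [Set.mem_sdiff, Set.mem_preimage]
    refine and_congr_left fun hx => ?_
    simp [reflect, hx]

/-! ### Sign patterns in an open half-space -/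

variable {ι E : Type*} [NormedAddCommGroup E] [NormedSpace ℝ E]

/-- The vectors `y i` lie in a common open half-space bounded by a hyperplane through `0`. -/
def InOpenHalfSpace (y : ι → E) : Prop :=
  ∃ φ : StrongDual ℝ E, ∀ i, 0 < φ (y i)

/-- Given a relation `∑ g i • y i = 0`, take `φ` whose signs match those of `g`. All terms `g i * φ
(y i)` are nonnegative with sum 0, so `g = 0`: the vectors are independent. -/
lemma card_le_finrank_of_sign_patterns [FiniteDimensional ℝ E] (y : ι → E) (s : Finset ι)
    (h : ∀ t ⊆ s, ∃ φ : StrongDual ℝ E, (∀ i ∈ t, φ (y i) < 0) ∧ ∀ i ∈ s, i ∉ t → 0 < φ (y i)) :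
    s.card ≤ Module.finrank ℝ E := by
  classical
  have hli : LinearIndependent ℝ fun i : s => y i := by
    rw [Fintype.linearIndependent_iff]
    intro g hg
    obtain ⟨φ, h1, h2⟩ := h {i ∈ s | ∃ hi : i ∈ s, g ⟨i, hi⟩ < 0} (Finset.filter_subset _ _)
    have hsign : ∀ i : s, (g i < 0 ∧ φ (y i) < 0) ∨ (0 ≤ g i ∧ 0 < φ (y i)) := by
      intro i
      by_cases hi : g i < 0
      · exact Or.inl ⟨hi, h1 _ (by simp [hi])⟩
      · exact Or.inr ⟨not_lt.1 hi, h2 _ i.2 (by simpa using hi)⟩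
    have hsum : ∑ i : s, g i * φ (y i) = 0 := by
      simpa using congrArg φ hg
    have hnn : ∀ i ∈ Finset.univ, 0 ≤ g i * φ (y i) := fun i _ => by
      rcases hsign i with ⟨a, b⟩ | ⟨a, b⟩
      · exact (mul_pos_of_neg_of_neg a b).le
      · exact mul_nonneg a b.le
    intro i
    have h0 := (Finset.sum_eq_zero_iff_of_nonneg hnn).1 hsum i (Finset.mem_univ i)
    refine (mul_eq_zero.1 h0).resolve_right ?_
    rcases hsign i with ⟨_, b⟩ | ⟨_, b⟩
    · exact b.ne
    · exact b.ne'
  simpa using hli.fintype_card_le_finrank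

open Classical in
/-- The number of ways to reflect some of the vectors `y i`, `i ∈ T`, into a common open half-space
(the choices outside `T` being irrelevant). -/
lemma card_reflections_le [FiniteDimensional ℝ E] [Fintype ι] (y : ι → E) (T : Finset ι) :
    (Finset.univ.filter fun σ : Finset ι =>
      InOpenHalfSpace fun i => if i ∈ σ ∧ i ∈ T then -y i else y i).card ≤
    (∑ k ∈ Finset.range (Module.finrank ℝ E + 1), (Fintype.card ι).choose k) * 2 ^ Tᶜ.card := by
  set 𝒜 := Finset.univ.filter fun σ : Finset ι =>
    InOpenHalfSpace fun i => if i ∈ σ ∧ i ∈ T then -y i else y i with h𝒜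
  set ℱ := 𝒜.filter (· ⊆ T) with hℱ
  have hmem : ∀ σ, σ ∈ 𝒜 ↔ InOpenHalfSpace fun i => if i ∈ σ ∧ i ∈ T then -y i else y i := by
    simp [h𝒜]
  have hcard : 𝒜.card ≤ ℱ.card * Tᶜ.powerset.card := by
    rw [← Finset.card_product]
    refine Finset.card_le_card_of_injOn (fun σ => (σ ∩ T, σ ∩ Tᶜ)) (fun σ hσ => ?_) ?_
    · have hσ' := (hmem σ).1 hσ
      simp only [Finset.coe_product, Set.mem_prod, Finset.mem_coe, Finset.mem_powerset,
        Finset.inter_subset_right, and_true]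
      rw [hℱ, Finset.mem_filter, hmem]
      refine ⟨?_, Finset.inter_subset_right⟩
      simpa [Finset.mem_inter, and_assoc] using hσ'
    · intro σ _ τ _ h
      simp only [Prod.mk.injEq] at h
      ext i
      have h1 := Finset.ext_iff.1 h.1 i
      have h2 := Finset.ext_iff.1 h.2 i
      simp only [Finset.mem_inter, Finset.mem_compl] at h1 h2
      tauto
  -- A set shattered by `ℱ` realizes all sign patterns on its vectors.
  have hvc : ℱ.vcDim ≤ Module.finrank ℝ E := by
    refine Finset.sup_le fun s hs => ?_
    rw [Finset.mem_shatterer] at hs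
    have hsT : s ⊆ T := by
      obtain ⟨t, ht, hst⟩ := hs.exists_superset
      exact hst.trans (Finset.mem_filter.1 ht).2
    refine card_le_finrank_of_sign_patterns y s fun t ht => ?_
    obtain ⟨σ, hσ, hσt⟩ := hs ht
    obtain ⟨φ, hφ⟩ := (hmem σ).1 (Finset.mem_filter.1 hσ).1
    refine ⟨φ, fun i hi => ?_, fun i hi hit => ?_⟩
    · have h1 := hφ i
      dsimp only at h1
      rw [if_pos ⟨(Finset.mem_inter.1 (hσt ▸ hi)).2, hsT (ht hi)⟩, map_neg] at h1
      linarith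
    · have h1 := hφ i
      dsimp only at h1
      rwa [if_neg fun h => hit (hσt ▸ Finset.mem_inter.2 ⟨hi, h.1⟩)] at h1
  rw [Finset.card_powerset] at hcard
  refine hcard.trans (Nat.mul_le_mul_right _ ?_)
  refine ℱ.card_le_card_shatterer.trans (Finset.card_shatterer_le_sum_vcDim.trans ?_)
  refine Finset.sum_le_sum_of_subset fun k hk => ?_
  have := (Finset.mem_Iic.1 hk).trans hvc
  simp
  omega

lemma sum_choose_le_pow {M S : ℕ} (hM : 2 ≤ M) (hS : 2 ≤ S) :
    ∑ k ∈ Finset.range (S + 1), M.choose k ≤ M ^ S := by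
  induction S, hS using Nat.le_induction with
  | base =>
    simp only [Finset.sum_range_succ, Finset.sum_range_zero, Nat.choose_zero_right,
      Nat.choose_one_right]
    have h1 := Nat.choose_two_right M
    have h2 : M * (M - 1) / 2 * 2 ≤ M * (M - 1) := Nat.div_mul_le_self _ _
    obtain ⟨n, rfl⟩ : ∃ n, M = n + 2 := ⟨M - 2, by omega⟩
    simp only [show n + 2 - 1 = n + 1 by omega] at h1 h2
    nlinarith
  | succ n hn ih =>
    rw [Finset.sum_range_succ]
    -- The new term and the inductive bound `M ^ n` each take at most half of `M ^ (n + 1)`.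
    have h1 : 2 * M.choose (n + 1) ≤ M ^ (n + 1) := by
      have h2 : M.choose (n + 1) * (n + 1).factorial ≤ M ^ (n + 1) := by
        rw [mul_comm, ← Nat.descFactorial_eq_factorial_mul_choose]
        exact Nat.descFactorial_le_pow _ _
      have h3 : 2 ≤ (n + 1).factorial := by
        calc 2 = Nat.factorial 2 := rfl
          _ ≤ _ := Nat.factorial_le (by omega)
      nlinarith
    have h4 : 2 * M ^ n ≤ M ^ (n + 1) := by
      rw [pow_succ, mul_comm]; exact Nat.mul_le_mul_left _ hM
    omega

/-! ### Separating the centre from random points -/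

lemma mem_convexHull_of_not_inOpenHalfSpace {ι E : Type*} [Finite ι] [NormedAddCommGroup E]
    [NormedSpace ℝ E] {x : ι → E} {c : E} (h : ¬ InOpenHalfSpace fun i => x i - c) :
    c ∈ convexHull ℝ (Set.range x) := by
  by_contra hc
  obtain ⟨φ, r, h1, h2⟩ := geometric_hahn_banach_point_closed (convex_convexHull ℝ _)
    ((Set.finite_range x).isCompact_convexHull (𝕜 := ℝ)).isClosed hc
  refine h ⟨φ, fun i => ?_⟩
  have := h2 _ (subset_convexHull ℝ _ ⟨i, rfl⟩)
  rw [map_sub]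
  linarith

lemma isOpen_inOpenHalfSpace {ι E : Type*} [Finite ι] [NormedAddCommGroup E] [NormedSpace ℝ E]
    (c : E) : IsOpen {x : ι → E | InOpenHalfSpace fun i => x i - c} := by
  have : {x : ι → E | InOpenHalfSpace fun i => x i - c} =
      ⋃ φ : StrongDual ℝ E, ⋂ i, {x | 0 < φ (x i - c)} := by
    ext x; simp [InOpenHalfSpace]
  rw [this]
  exact isOpen_iUnion fun φ => isOpen_iInter_of_finite fun i =>
    isOpen_lt continuous_const (by fun_prop)

/-- The centre is separated from independent uniform points with small probability. The proof
averages over the reflections in the centre of all subfamilies of the points in the core. -/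
lemma pi_uniformSimplex_inOpenHalfSpace_le {S : ℕ} (hS : 2 ≤ S) {ι : Type*} [Fintype ι]
    (hι : 2 ≤ Fintype.card ι) :
    (Measure.pi fun _ : ι => uniformSimplex S).real
      {x | InOpenHalfSpace fun i => x i - center S} ≤
        (Fintype.card ι : ℝ) ^ S * v S ^ Fintype.card ι := by
  classical
  have := isProbabilityMeasure_uniformSimplex (S := S) (by omega)
  set ν := uniformSimplex S with hν
  set μ := Measure.pi fun _ : ι => ν with hμ
  set B : Set (ι → EuclideanSpace ℝ (Fin S)) :=
    {x | InOpenHalfSpace fun i => x i - center S} with hB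
  set M := Fintype.card ι with hM
  have hBm : MeasurableSet B := (isOpen_inOpenHalfSpace _).measurableSet
  let R : Finset ι → (ι → EuclideanSpace ℝ (Fin S)) → ι → EuclideanSpace ℝ (Fin S) :=
    fun σ x i => (if i ∈ σ then reflect S else id) (x i)
  have hR : ∀ σ, MeasurePreserving (R σ) μ μ := fun σ => by
    refine measurePreserving_pi (f := fun i => if i ∈ σ then reflect S else id) _ _ fun i => ?_
    split_ifs
    · exact measurePreserving_reflect S
    · exact MeasurePreserving.id _
  have hRB : ∀ σ, μ.real (R σ ⁻¹' B) = μ.real B := fun σ => by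
    rw [Measure.real, (hR σ).measure_preimage hBm.nullMeasurableSet, Measure.real]
  let T : (ι → EuclideanSpace ℝ (Fin S)) → Finset ι := fun x => {i | x i ∈ core S}
  have hcount : ∀ x, ∑ σ : Finset ι, (R σ ⁻¹' B).indicator (fun _ => (1 : ℝ)) x ≤
      (M : ℝ) ^ S * ∏ i, if x i ∈ core S then (1 : ℝ) else 2 := by
    intro x
    have h1 := card_reflections_le (fun i => x i - center S) (T x)
    have h2 : ∀ σ, x ∈ R σ ⁻¹' B ↔ InOpenHalfSpace fun i =>
        if i ∈ σ ∧ i ∈ T x then -(x i - center S) else x i - center S := by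
      intro σ
      rw [Set.mem_preimage, hB, Set.mem_ofPred_eq]
      congr! 2 with i
      by_cases hi : i ∈ σ <;> by_cases hx : x i ∈ core S <;> simp [R, T, hi, hx, reflect]
      rw [two_smul]; abel
    have h3 : ∑ σ : Finset ι, (R σ ⁻¹' B).indicator (fun _ => (1 : ℝ)) x =
        ((Finset.univ.filter fun σ : Finset ι => InOpenHalfSpace fun i =>
          if i ∈ σ ∧ i ∈ T x then -(x i - center S) else x i - center S).card : ℝ) := by
      simp_rw [Set.indicator_apply, h2]
      rw [Finset.sum_boole]
    have h4 : ∏ i, (if x i ∈ core S then (1 : ℝ) else 2) = 2 ^ (T x)ᶜ.card := by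
      rw [Finset.prod_ite, Finset.prod_const_one, one_mul, Finset.prod_const, Finset.compl_filter]
    rw [h3, h4]
    have h5 := h1.trans (Nat.mul_le_mul_right _ (by simpa using sum_choose_le_pow hι hS))
    exact_mod_cast h5
  have hint : ∀ σ, Integrable ((R σ ⁻¹' B).indicator fun _ => (1 : ℝ)) μ := fun σ =>
    (integrable_const _).indicator ((hR σ).measurable hBm)
  -- Writing the factor as 2 minus an indicator makes its mean `2 - u = 2v`.
  have hg : ∀ x, (if x ∈ core S then (1 : ℝ) else 2) =
      2 - (core S).indicator (fun _ => (1 : ℝ)) x := fun x => by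
    by_cases hx : x ∈ core S <;> simp [hx]; norm_num
  have hgi : Integrable (fun x => if x ∈ core S then (1 : ℝ) else 2) ν := by
    simp_rw [hg]
    exact (integrable_const _).sub
      ((integrable_const _).indicator (isClosed_core S).measurableSet)
  have hgint : ∫ x, (if x ∈ core S then (1 : ℝ) else 2) ∂ν = 2 * v S := by
    simp_rw [hg]
    rw [integral_sub (integrable_const _)
      ((integrable_const _).indicator (isClosed_core S).measurableSet),
      integral_indicator_const _ (isClosed_core S).measurableSet, uniformSimplex_core, v]
    simp
    ring
  have hmain : (2 : ℝ) ^ M * μ.real B ≤ (M : ℝ) ^ S * (2 * v S) ^ M := by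
    calc (2 : ℝ) ^ M * μ.real B = ∑ σ : Finset ι, μ.real (R σ ⁻¹' B) := by
          simp_rw [hRB]
          simp [hM]
      _ = ∫ x, ∑ σ : Finset ι, (R σ ⁻¹' B).indicator (fun _ => (1 : ℝ)) x ∂μ := by
          rw [integral_finsetSum _ fun σ _ => hint σ]
          refine Finset.sum_congr rfl fun σ _ => ?_
          rw [integral_indicator_const _ ((hR σ).measurable hBm)]
          simp
      _ ≤ ∫ x, (M : ℝ) ^ S * ∏ i, (if x i ∈ core S then (1 : ℝ) else 2) ∂μ :=
          integral_mono (integrable_finsetSum _ fun σ _ => hint σ)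
            ((Integrable.fintype_prod fun _ => hgi).const_mul _) hcount
      _ = (M : ℝ) ^ S * (2 * v S) ^ M := by
          rw [integral_const_mul, integral_fintype_prod_eq_pow
            (fun x : EuclideanSpace ℝ (Fin S) => if x ∈ core S then (1 : ℝ) else 2), hgint]
  rw [mul_pow, mul_left_comm] at hmain
  exact le_of_mul_le_mul_left hmain (by positivity)

/-! ### The probability bound and its limit -/

lemma bound_le_measure_good {S A : ℕ} (hS : 2 ≤ S) (hA : 2 ≤ A) {Ω : Type*} [MeasurableSpace Ω]
    {μ : Measure Ω} [IsProbabilityMeasure μ]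
    {X : (Fin S → Fin A) → Ω → EuclideanSpace ℝ (Fin S)} (hX : IsIIDUniform μ X) :
    bound S A ≤ μ.real {ω | Good fun f => X f ω} := by
  have hcard : Fintype.card (Fin S → Fin A) = A ^ S := by simp
  have h2 : 2 ≤ Fintype.card (Fin S → Fin A) := by
    rw [hcard]; exact hA.trans (Nat.le_self_pow (by omega) A)
  have hbad := pi_uniformSimplex_inOpenHalfSpace_le hS h2
  have hlaw := hX.1.hasLaw_pi hX.2
  rw [← hlaw.measureReal_eq (isOpen_inOpenHalfSpace _).measurableSet, hcard] at hbad
  set B : Set Ω := {ω | InOpenHalfSpace fun f => X f ω - center S}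
  have hae : ∀ᵐ ω ∂μ, ∀ f, X f ω ∈ simplex S ∧ X f ω ≠ center S := by
    refine ae_all_iff.2 fun f => ?_
    have h := (ae_mem_simplex S).and (ae_ne_center hS)
    rw [← (hX.2 f).map_eq] at h
    exact ae_of_ae_map (hX.2 f).aemeasurable h
  have hgood : ∀ᵐ ω ∂μ, ω ∈ Bᶜ → ω ∈ {ω | Good fun f => X f ω} := by
    filter_upwards [hae] with ω hω hB
    have h := maxEntropyNotAtPoint_of_center_mem (by omega) (fun f => (hω f).1)
      (fun f => (hω f).2) (mem_convexHull_of_not_inOpenHalfSpace hB)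
    refine ⟨h, fun m hm => m.maxEntropyNotDeterministic_iff.2 ?_⟩
    simp_rw [hm]
    exact h
  have h1 : μ.real Bᶜ ≤ μ.real {ω | Good fun f => X f ω} :=
    ENNReal.toReal_mono (measure_ne_top _ _) (measure_mono_ae hgood)
  -- Subadditivity suffices, so neither `B` nor the good event has to be measurable in `Ω`.
  have h3 : 1 ≤ μ.real B + μ.real Bᶜ := by
    have := measureReal_union_le (μ := μ) B Bᶜ
    simpa using this
  rw [bound]
  linarith

lemma v_pos_and_lt_one {S : ℕ} (hS : 0 < S) : 0 < v S ∧ v S < 1 := by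
  have h1 := u_pos hS
  have h2 := u_le_one hS
  constructor <;> rw [v] <;> linarith

lemma tendsto_bound {S : ℕ} (hS : 0 < S) : Tendsto (fun A : ℕ => bound S A) atTop (𝓝 1) := by
  obtain ⟨h0, h1⟩ := v_pos_and_lt_one hS
  -- `n ^ S * v ^ n → 0`, taken along `n = A ^ S`.
  have h := (tendsto_pow_const_mul_const_pow_of_lt_one S h0.le h1).comp
    (tendsto_pow_atTop (α := ℕ) hS.ne')
  simpa [bound, Function.comp_def] using h.const_sub 1

end StateEntropy

theorem theorem1 (S : ℕ) (hS : 2 ≤ S) :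
    -- the constant
    (0 < v S ∧ v S < 1) ∧
    -- there are `M = A ^ S` deterministic policies
    (∀ A : ℕ, Nat.card {π : Policy S A // π.IsDeterministic} = A ^ S) ∧
    -- in every MDP, the feasible state distributions form the polytope spanned by those of the
    -- deterministic policies, and entropy maximization over policies is the one over this polytope
    (∀ (A : ℕ) (m : MDP S A),
      m.feasible = convexHull ℝ (Set.range fun f => m.d (Policy.ofFun f)) ∧
      (m.MaxEntropyNotDeterministic ↔ MaxEntropyNotAtPoint fun f => m.d (Policy.ofFun f))) ∧
    -- the probability bound
    (∀ A : ℕ, 2 ≤ A → ∀ (Ω : Type*) [MeasurableSpace Ω] (μ : Measure Ω) [IsProbabilityMeasure μ]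
      (X : (Fin S → Fin A) → Ω → EuclideanSpace ℝ (Fin S)), IsIIDUniform μ X →
      bound S A ≤ μ.real {ω | Good fun f => X f ω}) ∧
    -- the bound, and hence the probability, tends to one as `A` grows
    Tendsto (fun A : ℕ => bound S A) atTop (𝓝 1) ∧
    (∀ ε : ℝ, 0 < ε → ∀ᶠ A : ℕ in atTop,
      ∀ (Ω : Type*) [MeasurableSpace Ω] (μ : Measure Ω) [IsProbabilityMeasure μ]
      (X : (Fin S → Fin A) → Ω → EuclideanSpace ℝ (Fin S)), IsIIDUniform μ X →
      1 - ε ≤ μ.real {ω | Good fun f => X f ω}) := by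
  refine ⟨v_pos_and_lt_one (by omega), card_isDeterministic S,
    fun A m => ⟨m.feasible_eq_convexHull, m.maxEntropyNotDeterministic_iff⟩,
    fun A hA Ω _ μ _ X hX => bound_le_measure_good hS hA hX, tendsto_bound (by omega),
    fun ε hε => ?_⟩
  filter_upwards [eventually_ge_atTop 2,
    (tendsto_bound (S := S) (by omega)).eventually (lt_mem_nhds (by linarith : 1 - ε < 1))]
    with A hA hb Ω _ μ _ X hX
  exact hb.le.trans (bound_le_measure_good hS hA hX)
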